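/- Let $X$ be a real topological vector space, let $C\subseteq X$ be non-empty, compact and convex, and let $f:C\times C\to\mathbb{R}$ be a function. Suppose that 1. for every non-empty finite subset $A$ of $C$ and every $x$ in the convex hull $\operatorname{co}(A)$ of $A$, one has $\max_{a\in A} f(x,a)\ge 0$; 2. for every $y\in C$, the set $\{x\in C : f(x,y)\ge 0\}$ is closed in $C$. Then the equilibrium problem for $f$ on $C$ has a solution, that is, there exists $x\in C$ such that $f(x,y)\ge 0$ for all $y\in C$. -/

import Mathlib

/-- The set of solutions of the equilibrium problem associated with the bifunction `f` on `C`: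
the points `x` of `C` such that `f(x, y) ≥ 0` for all `y` in `C`. -/
def equilibriumSolutions {X : Type*} (C : Set X) (f : C → C → ℝ) : Set C :=
  {x : C | ∀ y : C, 0 ≤ f x y}

/-! The sets `{x | 0 ≤ f x y}` are closed in a compact space, so it suffices that finitely many of
them meet. A maximum is nonnegative exactly when some term is, so hypothesis 1 is the KKM covering
condition. Barycentric coordinates pull the sets back to a simplex (`kkm_finite`). There KKM follows
by applying a form of Brouwer's theorem (`exists_mul_sum_le`) to the distance functions: a point
with `z j > 0` in the `j`-th set makes the total distance vanish. The Brouwer statement comes from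
approximate solutions on fine grids, supplied by Scarf's lemma, which is a parity count of dominant
sets. -/

open Finset

namespace Scarf

/-! ### Scarf's lemma by parity -/

section Combinatorial

variable {I V : Type*} [Fintype I] [DecidableEq I] [Fintype V] [DecidableEq V]

/-- A finite set `σ` is dominant for the family of rankings `v` if no point is, for every
ranking, strictly above the minimum of `σ`. -/
def Dominant (v : I → V → ℕ) (σ : Finset V) : Prop :=
  ∀ y, ∃ i, ∀ x ∈ σ, v i y ≤ v i x

omit [Fintype I] [DecidableEq I] [Fintype V] [DecidableEq V] in
theorem Dominant.mono {v : I → V → ℕ} {σ τ : Finset V} (h : Dominant v σ) (hτ : τ ⊆ σ) :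
    Dominant v τ := fun y =>
  let ⟨i, hi⟩ := h y
  ⟨i, fun x hx => hi x (hτ hx)⟩

omit [DecidableEq V] [Fintype I] [DecidableEq I] [Fintype V] in
theorem exists_argmin (v : I → V → ℕ) {τ : Finset V} (hτ : τ.Nonempty) :
    ∃ a : I → V, ∀ k, a k ∈ τ ∧ ∀ x ∈ τ, v k (a k) ≤ v k x := by
  choose a ha using fun k => τ.exists_min_image (v k) hτ
  exact ⟨a, ha⟩

omit [DecidableEq I] [Fintype V] in
/-- In a dominant set with as many elements as there are rankings, every element is the minimum for
exactly one ranking. -/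
theorem Dominant.exists_unique_ranking {v : I → V → ℕ} (hv : ∀ i, Function.Injective (v i))
    {σ : Finset V} (h : Dominant v σ) (hcard : σ.card = Fintype.card I) {y : V} (hy : y ∈ σ) :
    ∃ b : I → V, Function.Injective b ∧ (∀ k, b k ∈ σ ∧ ∀ x ∈ σ, v k (b k) ≤ v k x) ∧
      ∃ l, b l = y := by
  obtain ⟨b, hb⟩ := exists_argmin v ⟨y, hy⟩
  have key : ∀ z ∈ σ, ∃ l, b l = z := by
    intro z hz
    obtain ⟨l, hl⟩ := h z
    exact ⟨l, hv l (le_antisymm ((hb l).2 z hz) (hl _ (hb l).1))⟩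
  refine ⟨b, ?_, hb, key y hy⟩
  have himg : univ.image b = σ := by
    ext z
    simp only [mem_image, mem_univ, true_and]
    exact ⟨fun ⟨l, hl⟩ => hl ▸ (hb l).1, key z⟩
  have : (univ.image b).card = (univ : Finset I).card := by rw [himg, hcard, card_univ]
  have := card_image_iff.1 this
  simpa using this

/-- The points lying strictly above `τ` for all rankings except the `l`-th. -/
def above (v : I → V → ℕ) (a : I → V) (l : I) : Finset V :=
  univ.filter fun y => ∀ k, k ≠ l → v k (a k) < v k y

/-- The elements whose addition to `τ` yields a dominant set. -/
noncomputable def extensions (v : I → V → ℕ) (τ : Finset V) : Finset V :=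
  open Classical in univ.filter fun y => y ∉ τ ∧ Dominant v (insert y τ)

variable {v : I → V → ℕ} {τ : Finset V} {a : I → V}

/-- A point above `τ` outside ranking `i` can only be dominated through `i`, where `y` is maximal
among such points; any other point keeps a witness `k ≠ i`, since `y` does not lower that minimum.
The repeated minimum ensures `y ∉ τ`. -/
theorem mem_extensions_of_above (hτ : Dominant v τ)
    (ha : ∀ k, a k ∈ τ ∧ ∀ x ∈ τ, v k (a k) ≤ v k x) {i j : I} (hij : i ≠ j) (haij : a i = a j)
    (hv : ∀ i, Function.Injective (v i))
    {y : V} (hy : y ∈ above v a i) (hmax : ∀ z ∈ above v a i, v i z ≤ v i y) :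
    y ∈ extensions v τ := by
  simp only [above, mem_filter, mem_univ, true_and] at hy hmax
  simp only [extensions, mem_filter, mem_univ, true_and]
  constructor
  · intro hyτ
    obtain ⟨k, hk⟩ := hτ y
    by_cases hki : k = i
    · subst hki
      have : a k = y := hv k (le_antisymm ((ha k).2 y hyτ) (hk _ (ha k).1))
      have h2 := hy j hij.symm
      rw [← haij, this] at h2
      exact lt_irrefl _ h2
    · exact absurd (hk _ (ha k).1) (not_le.2 (hy k hki))
  · intro z
    by_cases hz : ∀ k, k ≠ i → v k (a k) < v k z
    · obtain ⟨k, hk⟩ := hτ z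
      have hki : k = i := by
        by_contra hki
        exact absurd (hk _ (ha k).1) (not_le.2 (hz k hki))
      subst hki
      refine ⟨k, fun x hx => ?_⟩
      rcases mem_insert.1 hx with rfl | hx
      · exact hmax z hz
      · exact hk x hx
    · push Not at hz
      obtain ⟨k, hki, hk⟩ := hz
      refine ⟨k, fun x hx => ?_⟩
      rcases mem_insert.1 hx with rfl | hx
      · exact hk.trans (hy k hki).le
      · exact hk.trans ((ha k).2 x hx)

/-- In the enlarged set distinct rankings have distinct minima, and `y` takes over only ranking `l`.
To break the tie `a i = a j`, `l` must be `i` or `j`. -/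
theorem above_of_mem_extensions (hcard : τ.card + 1 = Fintype.card I)
    (ha : ∀ k, a k ∈ τ ∧ ∀ x ∈ τ, v k (a k) ≤ v k x) {i j : I} (hij : i ≠ j) (haij : a i = a j)
    (hv : ∀ i, Function.Injective (v i)) {y : V} (hy : y ∈ extensions v τ) :
    ∃ l, (l = i ∨ l = j) ∧ y ∈ above v a l ∧ ∀ z ∈ above v a l, v l z ≤ v l y := by
  simp only [extensions, mem_filter, mem_univ, true_and] at hy
  obtain ⟨hyτ, hdom⟩ := hy
  obtain ⟨b, hbinj, hb, l, hl⟩ := hdom.exists_unique_ranking hv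
    (by rw [card_insert_of_notMem hyτ, hcard]) (mem_insert_self y τ)
  have hba : ∀ k, k ≠ l → b k = a k := by
    intro k hk
    have hne : b k ≠ y := fun h => hk (hbinj (h.trans hl.symm))
    have hbk : b k ∈ τ := mem_of_mem_insert_of_ne (hb k).1 hne
    exact hv k (le_antisymm ((hb k).2 _ (mem_insert_of_mem (ha k).1)) ((ha k).2 _ hbk))
  have habove : ∀ k, k ≠ l → v k (a k) < v k y := by
    intro k hk
    have h1 : v k (a k) ≤ v k y := hba k hk ▸ (hb k).2 y (mem_insert_self y τ)
    refine lt_of_le_of_ne h1 fun h => hyτ ?_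
    rw [← hv k h]
    exact (ha k).1
  refine ⟨l, ?_, by simpa [above] using habove, ?_⟩
  · by_contra hcon
    push Not at hcon
    exact hij (hbinj (by rw [hba i hcon.1.symm, hba j hcon.2.symm, haij]))
  · intro z hz
    simp only [above, mem_filter, mem_univ, true_and] at hz
    obtain ⟨k, hk⟩ := hdom z
    by_cases hkl : k = l
    · subst hkl
      exact hk y (mem_insert_self y τ)
    · exact absurd (hk _ (mem_insert_of_mem (ha k).1)) (not_le.2 (hz k hkl))

omit [DecidableEq V] in
theorem disjoint_above (hτ : Dominant v τ)
    (ha : ∀ k, a k ∈ τ ∧ ∀ x ∈ τ, v k (a k) ≤ v k x) {i j : I} (hij : i ≠ j) :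
    Disjoint (above v a i) (above v a j) := by
  rw [disjoint_left]
  intro y hi hj
  simp only [above, mem_filter, mem_univ, true_and] at hi hj
  obtain ⟨k, hk⟩ := hτ y
  by_cases hki : k = i
  · exact absurd (hk _ (ha k).1) (not_le.2 (hj k (by rw [hki]; exact hij)))
  · exact absurd (hk _ (ha k).1) (not_le.2 (hi k hki))

theorem card_extensions_eq_two (hτ : Dominant v τ) (hcard : τ.card + 1 = Fintype.card I)
    (ha : ∀ k, a k ∈ τ ∧ ∀ x ∈ τ, v k (a k) ≤ v k x) {i j : I} (hij : i ≠ j) (haij : a i = a j)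
    (hv : ∀ i, Function.Injective (v i)) (hi : (above v a i).Nonempty)
    (hj : (above v a j).Nonempty) : (extensions v τ).card = 2 := by
  obtain ⟨p, hp, hpm⟩ := exists_max_image _ (v i) hi
  obtain ⟨q, hq, hqm⟩ := exists_max_image _ (v j) hj
  have hpq : p ≠ q := fun h => disjoint_left.1 (disjoint_above hτ ha hij) hp (h ▸ hq)
  rw [card_eq_two]
  refine ⟨p, q, hpq, ?_⟩
  ext y
  simp only [mem_insert, mem_singleton]
  constructor
  · intro hy
    obtain ⟨l, rfl | rfl, hyl, hym⟩ := above_of_mem_extensions hcard ha hij haij hv hy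
    · exact Or.inl (hv _ (le_antisymm (hpm y hyl) (hym p hp)))
    · exact Or.inr (hv _ (le_antisymm (hqm y hyl) (hym q hq)))
  · rintro (rfl | rfl)
    · exact mem_extensions_of_above hτ ha hij haij hv hp hpm
    · exact mem_extensions_of_above hτ ha hij.symm haij.symm hv hq hqm

theorem card_extensions_eq_one (hτ : Dominant v τ) (hcard : τ.card + 1 = Fintype.card I)
    (ha : ∀ k, a k ∈ τ ∧ ∀ x ∈ τ, v k (a k) ≤ v k x) {i j : I} (hij : i ≠ j) (haij : a i = a j)
    (hv : ∀ i, Function.Injective (v i)) (hi : (above v a i).Nonempty)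
    (hj : above v a j = ∅) : (extensions v τ).card = 1 := by
  obtain ⟨p, hp, hpm⟩ := exists_max_image _ (v i) hi
  rw [card_eq_one]
  refine ⟨p, ?_⟩
  ext y
  simp only [mem_singleton]
  constructor
  · intro hy
    obtain ⟨l, rfl | rfl, hyl, hym⟩ := above_of_mem_extensions hcard ha hij haij hv hy
    · exact hv _ (le_antisymm (hpm y hyl) (hym p hp))
    · simp [hj] at hyl
  · rintro rfl
    exact mem_extensions_of_above hτ ha hij haij hv hp hpm

omit [DecidableEq I] [Fintype V] [DecidableEq V] in
theorem exists_argmin_eq (v : I → V → ℕ) (hcard : τ.card + 1 = Fintype.card I)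
    (hne : τ.Nonempty) :
    ∃ a : I → V, (∀ k, a k ∈ τ ∧ ∀ x ∈ τ, v k (a k) ≤ v k x) ∧
      ∃ i j, i ≠ j ∧ a i = a j := by
  obtain ⟨a, ha⟩ := exists_argmin v hne
  refine ⟨a, ha, ?_⟩
  obtain ⟨i, -, j, -, hij, h⟩ := exists_ne_map_eq_of_card_lt_of_maps_to
    (s := (univ : Finset I)) (t := τ) (f := a) (by rw [card_univ]; omega)
    (fun k _ => (ha k).1)
  exact ⟨i, j, hij, h⟩

/-- The elements of `σ` whose removal leaves exactly the colours different from `i₀`. -/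
def removable (c : V → I) (i₀ : I) (σ : Finset V) : Finset V :=
  σ.filter fun x => (σ.erase x).image c = univ.erase i₀

-- If removing `x` leaves every colour but `i₀` once, then `c x` is repeated by a single other `y`,
-- and exactly `x` and `y` are removable.
omit [Fintype V] in
theorem even_card_removable {c : V → I} {i₀ : I} {σ : Finset V}
    (hcard : σ.card = Fintype.card I) (hσ : σ.image c ≠ univ) : Even (removable c i₀ σ).card := by
  rcases (removable c i₀ σ).eq_empty_or_nonempty with h | ⟨x, hx⟩
  · simp [h]
  obtain ⟨hxσ, hx⟩ := mem_filter.1 hx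
  have hinj : Set.InjOn c (σ.erase x) := by
    rw [← card_image_iff, hx, card_erase_of_mem hxσ, card_erase_of_mem (mem_univ _), hcard,
      card_univ]
  have hcx : c x ≠ i₀ := by
    intro h
    apply hσ
    rw [← insert_erase hxσ, image_insert, hx, h, insert_erase (mem_univ _)]
  obtain ⟨y, hy, hyx⟩ : ∃ y ∈ σ.erase x, c y = c x := by
    rw [← mem_image, hx]
    simpa using hcx
  obtain ⟨hne, hyσ⟩ := mem_erase.1 hy
  suffices removable c i₀ σ = {x, y} by
    rw [this, card_pair hne.symm]
    decide
  ext z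
  simp only [removable, mem_filter, mem_insert, mem_singleton]
  constructor
  · rintro ⟨hz, hzi⟩
    by_contra hcon
    push Not at hcon
    have hinj' : Set.InjOn c (σ.erase z) := by
      rw [← card_image_iff, hzi, card_erase_of_mem hz, card_erase_of_mem (mem_univ _), hcard,
        card_univ]
    exact hne (hinj' (by simp [hyσ, hcon.2.symm]) (by simp [hxσ, hcon.1.symm]) hyx)
  · rintro (rfl | rfl)
    · exact ⟨hxσ, hx⟩
    · refine ⟨hyσ, ?_⟩
      rw [← hx]
      ext k
      simp only [mem_image, mem_erase]
      constructor
      · rintro ⟨w, ⟨hw, hwσ⟩, rfl⟩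
        by_cases hwx : w = x
        · exact ⟨z, ⟨hne, hyσ⟩, by rw [hyx, hwx]⟩
        · exact ⟨w, ⟨hwx, hwσ⟩, rfl⟩
      · rintro ⟨w, ⟨hw, hwσ⟩, rfl⟩
        by_cases hwy : w = z
        · exact ⟨x, ⟨hne.symm, hxσ⟩, by rw [← hyx, hwy]⟩
        · exact ⟨w, ⟨hwy, hwσ⟩, rfl⟩

/-- The dominant sets whose colours are, without repetition, all those different from `i₀`. -/
noncomputable def doors (v : I → V → ℕ) (c : V → I) (i₀ : I) : Finset (Finset V) :=
  open Classical in univ.filter fun τ =>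
    Dominant v τ ∧ τ.card + 1 = Fintype.card I ∧ τ.image c = univ.erase i₀

/-- Double counting of pairs: a door with an added point is a full-size dominant set with a removed
point. -/
theorem sum_card_extensions_doors (v : I → V → ℕ) (c : V → I) (i₀ : I) :
    ∑ τ ∈ doors v c i₀, (extensions v τ).card =
      ∑ σ ∈ (open Classical in
        univ.filter fun σ : Finset V => Dominant v σ ∧ σ.card = Fintype.card I),
        (removable c i₀ σ).card := by
  classical
  rw [← card_sigma, ← card_sigma]
  refine card_bij' (fun p _ => ⟨insert p.2 p.1, p.2⟩) (fun p _ => ⟨p.1.erase p.2, p.2⟩) ?_ ?_ ?_ ?_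
  · rintro ⟨τ, y⟩ h
    simp only [mem_sigma, doors, extensions, mem_filter, mem_univ, true_and, removable] at h ⊢
    obtain ⟨⟨h1, h2, h3⟩, h4, h5⟩ := h
    refine ⟨⟨h5, by rw [card_insert_of_notMem h4, h2]⟩, mem_insert_self _ _, ?_⟩
    rw [erase_insert h4, h3]
  · rintro ⟨σ, y⟩ h
    simp only [mem_sigma, doors, extensions, mem_filter, mem_univ, true_and, removable] at h ⊢
    obtain ⟨⟨h1, h2⟩, h3, h4⟩ := h
    refine ⟨⟨h1.mono (erase_subset _ _), by rw [card_erase_add_one h3, h2], h4⟩,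
      notMem_erase _ _, by rwa [insert_erase h3]⟩
  · rintro ⟨τ, y⟩ h
    simp only [mem_sigma, extensions, mem_filter] at h
    simp [erase_insert h.2.2.1]
  · rintro ⟨σ, y⟩ h
    simp only [mem_sigma, removable, mem_filter] at h
    simp [insert_erase h.2.1]

/-- A form of **Scarf's lemma**: given rankings indexed by `I` and, for each `i`, a point `s i` of
colour `i` that is lowest for the `i`-th ranking and above all ordinary points for the others,
there is a dominant set carrying each colour exactly once. -/
theorem exists_dominant_image_eq_univ [Nontrivial I] {v : I → V → ℕ}
    (hv : ∀ i, Function.Injective (v i)) (s : I → V)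
    (hmin : ∀ i x, v i (s i) ≤ v i x)
    (hmax : ∀ i j x, i ≠ j → x ∉ Set.range s → v j x < v j (s i))
    (hne : ∃ x, x ∉ Set.range s) (c : V → I) (hc : ∀ i, c (s i) = i) :
    ∃ σ : Finset V, Dominant v σ ∧ σ.card = Fintype.card I ∧ σ.image c = univ := by
  classical
  by_contra! hcon
  obtain ⟨i₀⟩ : Nonempty I := inferInstance
  have hs : Function.Injective s := fun i j h => by rw [← hc i, h, hc]
  -- The only door without ordinary points; it has one extension, all other doors have two, so the
  -- total is odd.
  set τ₀ : Finset V := (univ.erase i₀).image s with hτ₀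
  have hmem : τ₀ ∈ doors v c i₀ := by
    simp only [doors, mem_filter, mem_univ, true_and]
    refine ⟨?_, ?_, ?_⟩
    · intro y
      by_cases hy : y ∈ Set.range s
      · obtain ⟨j, rfl⟩ := hy
        exact ⟨j, fun x _ => hmin j x⟩
      · refine ⟨i₀, fun x hx => ?_⟩
        simp only [hτ₀, mem_image, mem_erase] at hx
        obtain ⟨l, ⟨hl, -⟩, rfl⟩ := hx
        exact (hmax l i₀ y hl hy).le
    · rw [card_image_of_injective _ hs, card_erase_add_one (mem_univ _), card_univ]
    · rw [hτ₀, image_image]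
      have : c ∘ s = id := funext hc
      rw [this, image_id]
  have hnonempty : ∀ τ ∈ doors v c i₀, τ.Nonempty := by
    intro τ hτ
    simp only [doors, mem_filter, mem_univ, true_and] at hτ
    have := Fintype.one_lt_card (α := I)
    rw [← card_pos]
    omega
  have hother : ∀ τ ∈ (doors v c i₀).erase τ₀, (extensions v τ).card % 2 = 0 := by
    intro τ hτ
    obtain ⟨hττ₀, hτ⟩ := mem_erase.1 hτ
    have hτne := hnonempty τ hτ
    simp only [doors, mem_filter, mem_univ, true_and] at hτ
    obtain ⟨hdom, hcard, himg⟩ := hτ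
    obtain ⟨a, ha, i, j, hij, haij⟩ := exists_argmin_eq v hcard hτne
    obtain ⟨t, htτ, ht⟩ : ∃ t ∈ τ, t ∉ Set.range s := by
      by_contra! hsub
      apply hττ₀
      ext x
      simp only [hτ₀, mem_image]
      constructor
      · intro hx
        obtain ⟨k, rfl⟩ := hsub x hx
        exact ⟨k, himg ▸ mem_image.2 ⟨_, hx, hc k⟩, rfl⟩
      · rintro ⟨k, hk, rfl⟩
        rw [← himg, mem_image] at hk
        obtain ⟨y, hy, rfl⟩ := hk
        obtain ⟨l, rfl⟩ := hsub y hy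
        rwa [hc]
    have habove : ∀ l, (above v a l).Nonempty := by
      refine fun l => ⟨s l, ?_⟩
      simp only [above, mem_filter, mem_univ, true_and]
      intro k hk
      exact ((ha k).2 t htτ).trans_lt (hmax l k t hk.symm ht)
    rw [card_extensions_eq_two hdom hcard ha hij haij hv (habove i) (habove j)]
  have houtside : (extensions v τ₀).card = 1 := by
    have hτne := hnonempty τ₀ hmem
    simp only [doors, mem_filter, mem_univ, true_and] at hmem
    obtain ⟨hdom, hcard, -⟩ := hmem
    obtain ⟨a, ha, i, j, hij, haij⟩ := exists_argmin_eq v hcard hτne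
    have hak : ∀ k, k ≠ i₀ → a k = s k := by
      intro k hk
      refine hv k (le_antisymm ((ha k).2 _ ?_) (hmin k _))
      exact mem_image_of_mem s (by simp [hk])
    wlog hi : i = i₀ generalizing i j
    · by_cases hj : j = i₀
      · exact this j i hij.symm haij.symm hj
      · exact absurd (hs (by rw [← hak i hi, ← hak j hj, haij])) hij
    subst hi
    refine card_extensions_eq_one hdom hcard ha hij haij hv ?_ ?_
    · obtain ⟨t, ht⟩ := hne
      refine ⟨t, ?_⟩
      simp only [above, mem_filter, mem_univ, true_and]
      intro k hk
      rw [hak k hk]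
      exact lt_of_le_of_ne (hmin k t) fun h => ht ⟨k, hv k h⟩
    · rw [eq_empty_iff_forall_notMem]
      intro y hy
      simp only [above, mem_filter, mem_univ, true_and] at hy
      have h1 := hy i hij
      rw [haij, hak j hij.symm] at h1
      by_cases hyr : y ∈ Set.range s
      · obtain ⟨l, rfl⟩ := hyr
        by_cases hlj : l = j
        · exact absurd h1 (by simp [hlj])
        by_cases hli : l = i
        · exact absurd h1 (not_lt.2 (hli ▸ hmin l _))
        · have := hy l hlj
          rw [hak l hli] at this
          exact lt_irrefl _ this
      · exact absurd h1 (not_lt.2 (hmax j i y hij.symm hyr).le)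
  have hsum := sum_card_extensions_doors v c i₀
  rw [← add_sum_erase _ _ hmem, houtside] at hsum
  have heven1 : Even (∑ τ ∈ (doors v c i₀).erase τ₀, (extensions v τ).card) :=
    even_sum _ fun τ hτ => Nat.even_iff.2 (hother τ hτ)
  have heven2 : Even (∑ σ ∈ univ.filter fun σ : Finset V => Dominant v σ ∧
      σ.card = Fintype.card I, (removable c i₀ σ).card) :=
    even_sum _ fun σ hσ => by
      simp only [mem_filter, mem_univ, true_and] at hσ
      exact even_card_removable hσ.2 (hcon σ hσ.1 hσ.2)
  rw [← hsum] at heven2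
  exact (Nat.not_even_iff_odd.2 heven1.one_add) heven2

end Combinatorial

/-! ### Scarf's lemma on integer grids -/

section Grid

variable {I : Type*} [Fintype I] [DecidableEq I]

/-- Scarf's lemma on a finite set of points with natural number coordinates. -/
theorem exists_dominant_family [Nontrivial I] {T : Type*} [Fintype T] [Nonempty T]
    (p : T → I → ℕ) (c : T → I) :
    ∃ (C : Finset I) (x : I → T), (∀ i ∈ C, c (x i) = i) ∧
      ∀ y : T, ∃ i ∈ C, ∀ j ∈ C, p y i ≤ p (x j) i := by
  classical
  let e : T ≃ Fin (Fintype.card T) := Fintype.equivFin T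
  let e' : I ≃ Fin (Fintype.card I) := Fintype.equivFin I
  let M := Fintype.card T
  let B := (univ.sup fun t => univ.sup (p t)) * M + M + 1
  have hlt : ∀ i t, p t i * M + (e t : ℕ) + 1 < B + 1 := by
    intro i t
    have h1 : p t i ≤ univ.sup fun t => univ.sup (p t) :=
      (le_sup (f := p t) (mem_univ i)).trans
        (le_sup (f := fun t => univ.sup (p t)) (mem_univ t))
    have h2 := Nat.mul_le_mul_right M h1
    have h3 : (e t : ℕ) < M := (e t).2
    omega
  -- Ties between coordinates are broken by `e t < M`. The shift by one leaves 0 to the artificial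
  -- point `Sum.inr i` in its own ranking; elsewhere it exceeds all real points.
  let v : I → T ⊕ I → ℕ := fun i => Sum.elim (fun t => p t i * M + (e t : ℕ) + 1)
    fun j => if j = i then 0 else B + 1 + (e' j : ℕ)
  have hv : ∀ i, Function.Injective (v i) := by
    rintro i (t | j) (t' | j') h
    · simp only [v, Sum.elim_inl, add_left_inj] at h
      have ht : (e t : ℕ) < M := (e t).2
      have ht' : (e t' : ℕ) < M := (e t').2
      have h' := congrArg (· % M) h
      simp only [Nat.mul_add_mod_self_right, Nat.mod_eq_of_lt ht, Nat.mod_eq_of_lt ht'] at h'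
      rw [e.injective (Fin.ext h')]
    · simp only [v, Sum.elim_inl, Sum.elim_inr] at h
      have := hlt i t
      split_ifs at h
      omega
    · simp only [v, Sum.elim_inl, Sum.elim_inr] at h
      have := hlt i t'
      split_ifs at h
      omega
    · simp only [v, Sum.elim_inr] at h
      split_ifs at h with h1 h2 h2
      · rw [h1, h2]
      · omega
      · omega
      · exact congrArg Sum.inr (e'.injective (Fin.ext (by omega)))
  obtain ⟨σ, hdom, hcard, hcol⟩ := exists_dominant_image_eq_univ hv Sum.inr
    (fun i x => by simp [v])
    (by
      rintro i j (t | k) hij hx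
      · have := hlt j t
        simp only [v, Sum.elim_inl, Sum.elim_inr, if_neg hij]
        omega
      · exact absurd ⟨k, rfl⟩ hx)
    ⟨Sum.inl (Classical.arbitrary T), by simp⟩ (Sum.elim c id) (fun i => rfl)
  have hx : ∀ i, ∃ t, Sum.inr i ∉ σ → Sum.inl t ∈ σ ∧ c t = i := by
    intro i
    by_cases hi : Sum.inr i ∈ σ
    · exact ⟨Classical.arbitrary T, fun h => absurd hi h⟩
    · have : i ∈ σ.image (Sum.elim c id) := by rw [hcol]; exact mem_univ i
      obtain ⟨(t | j), ht, htc⟩ := mem_image.1 this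
      · exact ⟨t, fun _ => ⟨ht, htc⟩⟩
      · simp only [Sum.elim_inr, id] at htc
        exact absurd (htc ▸ ht) hi
  choose x hx using hx
  refine ⟨univ.filter fun i => Sum.inr i ∉ σ, x, ?_, ?_⟩
  · intro i hi
    exact (hx i (by simpa using hi)).2
  · intro y
    obtain ⟨i, hi⟩ := hdom (Sum.inl y)
    have hiσ : Sum.inr i ∉ σ := by
      intro h
      have := hi _ h
      simp [v] at this
    refine ⟨i, by simpa using hiσ, fun j hj => ?_⟩
    have h1 := hi _ (hx j (by simpa using hj)).1
    simp only [v, Sum.elim_inl, add_le_add_iff_right] at h1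
    by_contra! hlt'
    have h2 : (e (x j) : ℕ) < M := (e (x j)).2
    have h3 : (p (x j) i + 1) * M ≤ p y i * M := Nat.mul_le_mul_right M hlt'
    rw [add_mul, one_mul] at h3
    omega

/-- Colouring the points of the grid `{x | ∑ i, x i = N}` produces a cluster of points `x i`, of
colour `i` for `i` in some nonempty `C`, whose coordinates outside `C` are small. -/
theorem exists_grid_cluster [Nontrivial I] (N : ℕ) (c : (I → ℕ) → I) :
    ∃ (C : Finset I) (x : I → I → ℕ), C.Nonempty ∧ (∀ i, ∑ k, x i k = N) ∧
      (∀ i ∈ C, c (x i) = i) ∧ (∀ i ∈ C, ∀ j ∉ C, x i j ≤ Fintype.card I) ∧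
      ∀ i ∈ C, ∀ j ∈ C, ∀ k, x i k ≤ x j k + Fintype.card I := by
  obtain ⟨i₀⟩ : Nonempty I := inferInstance
  let T := {y : I → ℕ // y ∈ piAntidiag univ N}
  have hT : ∀ y : T, ∑ k, y.1 k = N := fun y => by
    have := y.2
    simp only [mem_piAntidiag] at this
    exact this.1
  let _ : Fintype T := inferInstanceAs (Fintype {y : I → ℕ // y ∈ piAntidiag univ N})
  have : Nonempty T := ⟨⟨Pi.single i₀ N, by simp⟩⟩
  obtain ⟨C, x, hc, hdom⟩ := exists_dominant_family (fun y : T => y.1) (fun y : T => c y.1)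
  have hC : C.Nonempty := by
    obtain ⟨i, hi, -⟩ := hdom (Classical.arbitrary T)
    exact ⟨i, hi⟩
  let m : I → ℕ := fun k => C.inf' hC fun j => (x j).1 k
  have hm : ∀ j ∈ C, ∀ k, m k ≤ (x j).1 k := fun j hj k => inf'_le (fun j => (x j).1 k) hj
  -- Otherwise some grid point exceeds `m` on all of `C`, against dominance. Hence each cluster
  -- point has total excess over `m` (extended by 0 off `C`) less than `C.card`.
  have hsum : N < ∑ k ∈ C, (m k + 1) := by
    by_contra! hle
    obtain ⟨j, hj⟩ := hC
    let y : I → ℕ := fun k => (if k ∈ C then m k + 1 else 0) +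
      (Pi.single j (N - ∑ k ∈ C, (m k + 1)) : I → ℕ) k
    have hy : ∑ k, y k = N := by
      simp only [y, sum_add_distrib, sum_ite_mem, univ_inter, sum_pi_single', mem_univ, if_true]
      simp only [sum_add_distrib] at hle
      omega
    obtain ⟨i, hi, hle'⟩ := hdom ⟨y, by simp [hy]⟩
    have h1 : y i ≤ m i := le_inf' _ _ hle'
    have h2 : m i + 1 ≤ y i := by simp [y, hi]
    omega
  have hCcard : C.card ≤ Fintype.card I := card_le_univ C
  rw [sum_add_distrib, sum_const, smul_eq_mul, mul_one] at hsum
  have hsplit : ∀ j, ∑ k ∈ C, (x j).1 k + ∑ k ∈ Cᶜ, (x j).1 k = N := fun j => by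
    rw [sum_add_sum_compl, hT]
  have hout : ∀ i ∈ C, ∀ j ∉ C, (x i).1 j ≤ Fintype.card I := by
    intro i hi j hj
    have h1 : ∑ k ∈ C, m k ≤ ∑ k ∈ C, (x i).1 k := sum_le_sum fun k _ => hm i hi k
    have h2 : (x i).1 j ≤ ∑ k ∈ Cᶜ, (x i).1 k :=
      single_le_sum (f := (x i).1) (fun _ _ => Nat.zero_le _) (mem_compl.2 hj)
    have h3 := hsplit i
    omega
  refine ⟨C, fun i => (x i).1, hC, fun i => hT _, hc, hout, ?_⟩
  intro i hi j hj k
  change (x i).1 k ≤ (x j).1 k + Fintype.card I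
  by_cases hk : k ∈ C
  · have h1 : ∑ l ∈ C.erase k, m l ≤ ∑ l ∈ C.erase k, (x i).1 l :=
      sum_le_sum fun l _ => hm i hi l
    have h2 := add_sum_erase C m hk
    have h3 := add_sum_erase C (x i).1 hk
    have h4 := hsplit i
    have h5 := hm j hj k
    omega
  · exact (hout i hi k hk).trans (Nat.le_add_left _ _)

end Grid

/-! ### Brouwer and KKM on the simplex -/

section Simplex

variable {I : Type*} [Fintype I]

/-- These differences sum to zero. Such an index will colour a grid point. -/
theorem exists_nonneg_sub_mul_sum [Nonempty I] (d z : I → ℝ) (hz : z ∈ stdSimplex ℝ I) :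
    ∃ i, 0 ≤ d i - z i * ∑ k, d k := by
  by_contra! h
  have h1 : ∑ i, (d i - z i * ∑ k, d k) < ∑ _i : I, (0 : ℝ) :=
    sum_lt_sum_of_nonempty univ_nonempty fun i _ => h i
  rw [sum_sub_distrib, ← sum_mul, hz.2] at h1
  simp at h1

theorem exists_approx_mul_sum_le [Nontrivial I] (d : I → (I → ℝ) → ℝ)
    (hd : ∀ i, Continuous (d i)) (hd0 : ∀ i z, 0 ≤ d i z) {ε : ℝ} (hε : 0 < ε) :
    ∃ z ∈ stdSimplex ℝ I, ∀ i, -ε ≤ d i z - z i * ∑ k, d k z := by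
  classical
  let g : (I → ℝ) → I → ℝ := fun z i => d i z - z i * ∑ k, d k z
  have hg : Continuous g := by fun_prop
  have hunif := (isCompact_stdSimplex ℝ I).uniformContinuousOn_of_continuous hg.continuousOn
  obtain ⟨δ, hδ, hunif⟩ := Metric.uniformContinuousOn_iff.1 hunif ε hε
  obtain ⟨B, hB⟩ := (isCompact_stdSimplex ℝ I).exists_bound_of_continuousOn
    (f := fun z => ∑ k, d k z) (by fun_prop)
  have hB0 : 0 < max B 1 := lt_max_of_lt_right one_pos
  obtain ⟨N, hN⟩ := exists_nat_gt ((Fintype.card I : ℝ) / min δ (ε / max B 1))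
  have hmin : 0 < min δ (ε / max B 1) := lt_min hδ (div_pos hε hB0)
  have hN0 : (0 : ℝ) < N := lt_of_le_of_lt (by positivity) hN
  have hsmall : (Fintype.card I : ℝ) / N < min δ (ε / max B 1) := by
    rw [div_lt_iff₀ hmin] at hN
    rw [div_lt_iff₀ hN0]
    linarith
  let q : (I → ℕ) → I → ℝ := fun y k => (y k : ℝ) / N
  have hq : ∀ y : I → ℕ, ∑ k, y k = N → q y ∈ stdSimplex ℝ I := by
    intro y hy
    refine ⟨fun k => by positivity, ?_⟩
    simp only [q]
    rw [← sum_div, ← Nat.cast_sum, hy, div_self hN0.ne']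
  have hcol : ∀ y : I → ℕ, ∃ i, ∑ k, y k = N → 0 ≤ g (q y) i := by
    intro y
    by_cases hy : ∑ k, y k = N
    · obtain ⟨i, hi⟩ := exists_nonneg_sub_mul_sum (fun k => d k (q y)) (q y) (hq y hy)
      exact ⟨i, fun _ => hi⟩
    · exact ⟨Classical.arbitrary I, fun h => absurd h hy⟩
  choose c hc using hcol
  obtain ⟨C, x, ⟨j, hj⟩, hxN, hxc, hout, hclose⟩ := exists_grid_cluster N c
  refine ⟨q (x j), hq _ (hxN j), fun i => ?_⟩
  -- For `i ∈ C`, uniform continuity carries the sign from the nearby point coloured `i`; for `i ∉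
  -- C`, the coordinate is so small that the subtracted term is at most `ε`.
  by_cases hi : i ∈ C
  · have h1 : 0 ≤ g (q (x i)) i := by
      have := hc (x i) (hxN i)
      rwa [hxc i hi] at this
    have h2 : dist (q (x i)) (q (x j)) < δ := by
      refine lt_of_le_of_lt ?_ (hsmall.trans_le (min_le_left _ _))
      rw [dist_pi_le_iff (by positivity)]
      intro k
      rw [Real.dist_eq]
      simp only [q]
      rw [← sub_div, abs_div, abs_of_pos hN0]
      gcongr
      have h3 : (x i k : ℝ) ≤ x j k + Fintype.card I := by exact_mod_cast hclose i hi j hj k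
      have h4 : (x j k : ℝ) ≤ x i k + Fintype.card I := by exact_mod_cast hclose j hj i hi k
      rw [abs_le]
      constructor <;> linarith
    have h3 := (dist_le_pi_dist (g (q (x i))) (g (q (x j))) i).trans_lt
      (hunif _ (hq _ (hxN i)) _ (hq _ (hxN j)) h2)
    rw [Real.dist_eq, abs_lt] at h3
    have h4 : -ε ≤ g (q (x j)) i := by linarith
    exact h4
  · have h1 : q (x j) i ≤ ε / max B 1 := by
      refine le_trans ?_ (hsmall.le.trans (min_le_right _ _))
      simp only [q]
      gcongr
      exact hout j hj i hi
    have h2 : ∑ k, d k (q (x j)) ≤ max B 1 :=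
      ((le_abs_self _).trans (hB _ (hq _ (hxN j)))).trans (le_max_left _ _)
    have h3 : q (x j) i * ∑ k, d k (q (x j)) ≤ ε / max B 1 * max B 1 :=
      mul_le_mul h1 h2 (sum_nonneg fun k _ => hd0 k _) (by positivity)
    rw [div_mul_cancel₀ _ hB0.ne'] at h3
    have := hd0 i (q (x j))
    linarith

/-- For nonnegative continuous functions `d i` on the standard simplex there is a point at which
the vector `(d i z)` dominates its total mass times `z`. This is the content of Brouwer's fixed
point theorem for the map `z ↦ (z + d z) / (1 + ∑ k, d k z)`. -/
theorem exists_mul_sum_le [Nonempty I] (d : I → (I → ℝ) → ℝ)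
    (hd : ∀ i, Continuous (d i)) (hd0 : ∀ i z, 0 ≤ d i z) :
    ∃ z ∈ stdSimplex ℝ I, ∀ i, z i * ∑ k, d k z ≤ d i z := by
  classical
  rcases subsingleton_or_nontrivial I with hI | hI
  · obtain ⟨j⟩ := ‹Nonempty I›
    refine ⟨Pi.single j 1, single_mem_stdSimplex ℝ j, fun i => ?_⟩
    rw [Subsingleton.elim i j, Fintype.sum_subsingleton _ j]
    simp
  let G : (I → ℝ) → ℝ := fun z =>
    univ.inf' univ_nonempty fun i => d i z - z i * ∑ k, d k z
  have hG : Continuous G :=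
    Continuous.finset_inf'_apply univ_nonempty fun i _ => by fun_prop
  obtain ⟨i₀⟩ := ‹Nonempty I›
  obtain ⟨z, hz, hmax⟩ := (isCompact_stdSimplex ℝ I).exists_isMaxOn
    ⟨_, single_mem_stdSimplex ℝ i₀⟩ hG.continuousOn
  refine ⟨z, hz, fun i => ?_⟩
  have hGz : 0 ≤ G z := by
    refine le_of_forall_pos_le_add fun ε hε => ?_
    obtain ⟨w, hw, hwε⟩ := exists_approx_mul_sum_le d hd hd0 hε
    have h1 : -ε ≤ G w := le_inf' _ _ fun i _ => hwε i
    have h2 : G w ≤ G z := hmax hw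
    linarith
  have h3 : G z ≤ d i z - z i * ∑ k, d k z := inf'_le _ (mem_univ i)
  linarith

/-- The **Knaster–Kuratowski–Mazurkiewicz lemma** on the standard simplex. -/
theorem kkm_stdSimplex [Nonempty I] (F : I → Set (I → ℝ)) (hF : ∀ i, IsClosed (F i))
    (hcov : ∀ z ∈ stdSimplex ℝ I, ∃ i, 0 < z i ∧ z ∈ F i) :
    ∃ z ∈ stdSimplex ℝ I, ∀ i, z ∈ F i := by
  classical
  -- `Metric.infDist` to the empty set is 0, so emptiness must be excluded; the vertices do this.
  have hne : ∀ i, (F i).Nonempty := by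
    intro i
    obtain ⟨j, hj, hjF⟩ := hcov _ (single_mem_stdSimplex ℝ i)
    have : j = i := by
      by_contra h
      simp [h] at hj
    exact ⟨_, this ▸ hjF⟩
  obtain ⟨z, hz, hle⟩ := exists_mul_sum_le (fun i z => Metric.infDist z (F i))
    (fun i => Metric.continuous_infDist_pt _) (fun i z => Metric.infDist_nonneg)
  refine ⟨z, hz, fun i => ?_⟩
  obtain ⟨j, hj, hjF⟩ := hcov z hz
  have h1 := hle j
  rw [Metric.infDist_zero_of_mem hjF] at h1
  have h2 : ∑ k, Metric.infDist z (F k) = 0 :=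
    le_antisymm (nonpos_of_mul_nonpos_right h1 hj) (sum_nonneg fun k _ => Metric.infDist_nonneg)
  rw [sum_eq_zero_iff_of_nonneg fun k _ => Metric.infDist_nonneg] at h2
  exact ((hF i).mem_iff_infDist_zero (hne i)).2 (h2 i (mem_univ i))

end Simplex

/-! ### Transfer to topological vector spaces -/

/-- The **KKM principle** for finitely many points of a convex set in a topological vector space:
if the convex hull of every subfamily is covered by the corresponding relatively closed sets,
these sets have a common point. -/
theorem kkm_finite {X I : Type*} [AddCommGroup X] [Module ℝ X] [TopologicalSpace X]
    [ContinuousAdd X] [ContinuousSMul ℝ X] [Fintype I] [Nonempty I] {C : Set X}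
    (hC : Convex ℝ C) (a : I → C) (F : I → Set C) (hF : ∀ i, IsClosed (F i))
    (hcov : ∀ (S : Finset I) (x : C), S.Nonempty →
      (x : X) ∈ convexHull ℝ ((fun i => (a i : X)) '' (S : Set I)) → ∃ i ∈ S, x ∈ F i) :
    ∃ x, ∀ i, x ∈ F i := by
  classical
  let φ : stdSimplex ℝ I → C := fun z =>
    ⟨∑ i, z.1 i • (a i : X), hC.sum_mem (fun i _ => z.2.1 i) z.2.2 fun i _ => (a i).2⟩
  have hφ : Continuous φ := by
    refine Continuous.subtype_mk ?_ _
    exact continuous_finsetSum _ fun i _ =>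
      ((continuous_apply i).comp continuous_subtype_val).smul continuous_const
  have hclosed := fun i => ((isClosed_stdSimplex ℝ I).isClosedEmbedding_subtypeVal.isClosedMap _
    ((hF i).preimage hφ))
  obtain ⟨z, hz, hzF⟩ := kkm_stdSimplex (fun i => Subtype.val '' (φ ⁻¹' F i)) hclosed (by
    intro z hz
    have hsum : ∑ i ∈ univ.filter (fun i => 0 < z i), z i = 1 := by
      rw [← hz.2]
      refine sum_subset (filter_subset _ _) fun i _ hi => ?_
      exact le_antisymm (by simpa using hi) (hz.1 i)
    have hSne : (univ.filter fun i => 0 < z i).Nonempty := by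
      by_contra h
      rw [not_nonempty_iff_eq_empty.1 h] at hsum
      simp at hsum
    -- Covering is applied to the support of `z`, so the index found has `0 < z i`.
    obtain ⟨i, hi, hiF⟩ := hcov (univ.filter fun i => 0 < z i) (φ ⟨z, hz⟩) hSne (by
      have : ((φ ⟨z, hz⟩ : C) : X) = ∑ i ∈ univ.filter (fun i => 0 < z i), z i • (a i : X) := by
        refine (sum_subset (filter_subset _ _) fun i _ hi => ?_).symm
        have : z i = 0 := le_antisymm (by simpa using hi) (hz.1 i)
        change z i • (a i : X) = 0
        rw [this, zero_smul]
      rw [this]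
      exact (convex_convexHull ℝ _).sum_mem (fun i _ => hz.1 i) hsum fun i hi =>
        subset_convexHull ℝ _ ⟨i, hi, rfl⟩)
    exact ⟨i, (mem_filter.1 hi).2, ⟨z, hz⟩, hiF, rfl⟩)
  refine ⟨φ ⟨z, hz⟩, fun i => ?_⟩
  obtain ⟨w, hw, rfl⟩ := hzF i
  exact hw

end Scarf

theorem corollary4p4 {X : Type*} [AddCommGroup X] [Module ℝ X] [TopologicalSpace X]
    [IsTopologicalAddGroup X] [ContinuousSMul ℝ X]
    (C : Set X) (hCcompact : IsCompact C) (hCconvex : Convex ℝ C) (hCne : C.Nonempty)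
    (f : C → C → ℝ)
    (hmax : ∀ (A : Finset C) (hA : A.Nonempty) (x : C),
      (x : X) ∈ convexHull ℝ ((fun a : C => (a : X)) '' (A : Set C)) →
        0 ≤ A.sup' hA (fun a => f x a))
    (hclosed : ∀ y : C, IsClosed {x : C | 0 ≤ f x y}) :
    (equilibriumSolutions C f).Nonempty := by
  classical
  have := isCompact_iff_compactSpace.1 hCcompact
  have hfin : ∀ A : Finset C, (Set.univ ∩ ⋂ y ∈ A, {x : C | 0 ≤ f x y}).Nonempty := by
    intro A
    rcases A.eq_empty_or_nonempty with rfl | hA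
    · obtain ⟨x, hx⟩ := hCne
      exact ⟨⟨x, hx⟩, by simp⟩
    have : Nonempty A := hA.to_subtype
    obtain ⟨x, hx⟩ := Scarf.kkm_finite hCconvex (fun y : A => y.1)
      (fun y => {x : C | 0 ≤ f x y.1}) (fun y => hclosed y.1) (by
        intro S x hS hx
        have h := hmax (S.image Subtype.val) (hS.image _) x (by
          rw [coe_image, Set.image_image]
          exact hx)
        rw [le_sup'_iff] at h
        obtain ⟨y, hy, hxy⟩ := h
        obtain ⟨w, hw, rfl⟩ := mem_image.1 hy
        exact ⟨w, hw, hxy⟩)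
    exact ⟨x, Set.mem_univ x, Set.mem_iInter₂.2 fun y hy => hx ⟨y, hy⟩⟩
  obtain ⟨x, -, hx⟩ := isCompact_univ.inter_iInter_nonempty _ hclosed hfin
  exact ⟨x, fun y => Set.mem_iInter.1 hx y⟩
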